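/- For a field $k$ and positive integers $a,b,c$ let $$B_{(a,b,c)}(k) := k[X,Y,Z]/(X^a+Y^b+Z^c).$$ An \emph{exponential map} on a commutative $k$-algebra $A$ is a $k$-algebra homomorphism $\phi=\phi_U : A\to A[U]$ such that (i) $\varepsilon_0\phi_U=\mathrm{id}_A$, where $\varepsilon_0:A[U]\to A$ is evaluation at $U=0$, and (ii) $\phi_V\phi_U=\phi_{V+U}$ as maps $A\to A[U,V]$, where $\phi_V:A\to A[V]$ is extended to $A[U]\to A[U,V]$ by $\phi_V(U)=U$. It is \emph{non-trivial} if $A^\phi:=\{a\in A : \phi(a)=a\}\neq A$. The $k$-algebra $A$ is \emph{rigid} if it has no non-trivial exponential map. Let $c>1$ be an odd integer. (1) If $k$ is a field of characteristic different from $2$ that does not contain a square root of $-1$, then the $k$-algebra $B_{(2,2,c)}(k)$ is rigid. (2) In contrast, if $K$ is an algebraically closed field, then the $K$-algebra $B_{(2,2,c)}(K)$ is not rigid. -/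

import Mathlib

open Polynomial

/-- A `k`-algebra homomorphism `φ = φ_U : A → A[U]` is an exponential map if evaluation at `U = 0`
after `φ_U` is the identity of `A`, and `φ_V φ_U = φ_{V+U}` as maps `A → A[U, V]`.

Here `A[U, V]` is `A[X][X]`, with `V = C X` (the inner variable) and `U = X` (the outer variable).
The extension `A[U] → A[U, V]` of `φ_V` with `U ↦ U` is `Polynomial.map` of `φ`, and `φ_{V+U} a` is
`φ_U a` with `V + U` substituted for `U`. -/
structure IsExponentialMap {k A : Type*} [CommRing k] [CommRing A] [Algebra k A]
    (φ : A →ₐ[k] A[X]) : Prop where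
  eval_zero : ∀ a : A, (φ a).eval 0 = a
  map_map : ∀ a : A, (φ a).map (φ : A →+* A[X]) =
    (φ a).eval₂ ((C : A[X] →+* A[X][X]).comp (C : A →+* A[X])) (C X + X)

/-- The ring of invariants `A^φ = {a ∈ A | φ(a) = a}`. -/
noncomputable def expInvariants {k A : Type*} [CommRing k] [CommRing A] [Algebra k A]
    (φ : A →ₐ[k] A[X]) : Subalgebra k A :=
  AlgHom.equalizer φ (CAlgHom : A →ₐ[k] A[X])

/-- A `k`-algebra `A` is rigid if it has no non-trivial exponential map, i.e. no exponential map
`φ` with `A^φ ≠ A`. -/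
def IsRigid (k A : Type*) [CommRing k] [CommRing A] [Algebra k A] : Prop :=
  ¬ ∃ φ : A →ₐ[k] A[X], IsExponentialMap φ ∧ expInvariants φ ≠ ⊤

/-- The ring `B_{(a_1, …, a_n)} = k[X_1, …, X_n] / (X_1^{a_1} + ⋯ + X_n^{a_n})`. -/
abbrev PhamBrieskorn (k : Type*) [Field k] {n : ℕ} (a : Fin n → ℕ) : Type _ :=
  MvPolynomial (Fin n) k ⧸
    Ideal.span {∑ i : Fin n, (MvPolynomial.X i : MvPolynomial (Fin n) k) ^ a i}

/-!
Let `B = k[X, Y, Z] / (X² + Y² + Z^c)` with `c > 1` odd.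

Over an algebraically closed field of characteristic other than `2` the equation can be written
`u v = -Z^c`, and `u ↦ u`, `Z ↦ Z + u U` extends to `v`
(`PhamBrieskorn.not_isRigid_of_sq_eq_neg_one`). In characteristic `2` it reads
`(X + Y)² + Z^c = 0`, and `X` and `Y` can be translated together
(`PhamBrieskorn.not_isRigid_of_two_eq_zero`).

Now let `-1` be a non-square in `k`. Then `B` is a domain in which `a² + b² = 0` only for
`a = b = 0` (`PhamBrieskorn.sumTwoSqAnisotropic`); both facts are read off from
`B ≅ k[Y, Z][√-(Y² + Z^c)]`, where `Y² + Z^c` has odd degree in `Z`. Suppose that `φ` is a nontrivial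
exponential map.

* `φ` has an invariant `f` outside `k` (`IsExponentialMap.exists_invariant`). The leading coefficient
  of each `φ a` is invariant; if all of them were in `k`, the elements `a` with `φ a` of degree less
  than `n` would form a space of dimension at most `n`, but the monomials `Y^i Z^j` are too many.
* `B` is graded, with weights `c`, `c`, `2`. Replacing `φ` by its top forms
  (`exists_homogenization`) gives polynomials `x`, `y`, `z` in `B[U]`, not all constant, with
  constant terms `X`, `Y`, `Z` and `x² + y² + z^c = 0`, such that the top form `F` of `f` has the
  constant value `F(x, y, z) = F(X, Y, Z) ≠ 0`.
* As `c` is odd, `F` can be reduced to `Z^d H(X, Y)` with `H` a form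
  (`PhamBrieskorn.exists_eq_pow_mul_form`). If `d > 0`, then `z` is constant, hence so is `x² + y²`,
  hence so are `x` and `y`, because their leading terms cannot cancel.
* If `d = 0`, then over the algebraic closure of `k` some linear factor `α X + β Y` of `H` takes a
  constant value `w = α x + β y` (`exists_linear_form_natDegree_eq_zero`). If `α² + β² = 0`, the higher
  coefficients satisfy `x_j² + y_j² = 0` and vanish. Otherwise `s = α y - β x` satisfies
  `s² + w² + (α² + β²) z^c = 0` with `w ≠ 0` constant. If the characteristic does not divide `c`, such
  an `s` is constant by the polynomial Fermat–Catalan theorem (`natDegree_eq_zero_of_catalan`). If it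
  divides `c`, the derivation `D = X ∂/∂Y - Y ∂/∂X`, applied to the coefficients, kills `z^c` and
  gives `s D(s) = -w D(w)`, a nonzero constant (`natDegree_eq_zero_of_derivation`). In both cases
  `x`, `y` and `z` are constant, a contradiction.
-/

/-! ### Top forms of a homomorphism to a polynomial ring -/

/-- A weighted homogeneous polynomial of weight `n` takes the factor `t ^ n` out of variables scaled
by `t ^ w i`. -/
lemma MvPolynomial.IsWeightedHomogeneous.aeval_pow_mul {k A σ : Type*} [CommRing k] [CommRing A]
    [Algebra k A] {w : σ → ℕ} {F : MvPolynomial σ k} {n : ℕ} (hF : F.IsWeightedHomogeneous w n)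
    (t : A) (a : σ → A) :
    MvPolynomial.aeval (fun i => t ^ w i * a i) F = t ^ n * MvPolynomial.aeval a F := by
  induction hF using MvPolynomial.IsWeightedHomogeneous.induction_on with
  | zero => simp
  | add p q _ _ hp hq => simp [hp, hq, mul_add]
  | monomial d r hd =>
    rw [MvPolynomial.aeval_monomial, MvPolynomial.aeval_monomial]
    have : (d.prod fun i k => (t ^ w i * a i) ^ k) = t ^ n * d.prod fun i k => a i ^ k := by
      simp only [Finsupp.prod, mul_pow, Finset.prod_mul_distrib, ← pow_mul]
      rw [Finset.prod_pow_eq_pow_sum, ← hd, Finsupp.weight_apply, Finsupp.sum]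
      simp [mul_comm]
    rw [this]; ring

/-- Substituting `T ^ (-e)` into a polynomial and multiplying by a large enough power of `T` gives a
polynomial again, whose constant coefficient is the former leading coefficient if that power is as
small as possible. -/
lemma exists_toLaurent_eq_T_mul_aeval {A : Type*} [CommRing A] (p : A[X]) (e : ℕ) (he : e ≠ 0)
    (m : ℤ) (h : p ≠ 0 → (e : ℤ) * p.natDegree ≤ m) :
    ∃ q : A[X], toLaurent q = LaurentPolynomial.T m *
        aeval (LaurentPolynomial.T (-(e : ℤ)) : LaurentPolynomial A) p ∧
      (m = e * p.natDegree → q.coeff 0 = p.leadingCoeff) := by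
  rcases eq_or_ne p 0 with rfl | hp
  · exact ⟨0, by simp, by simp⟩
  have h := h hp
  have hi : ∀ i ∈ Finset.range (p.natDegree + 1), (e : ℤ) * i ≤ m := by
    intro i hi
    have : (i : ℤ) ≤ p.natDegree := by have := Finset.mem_range.1 hi; omega
    nlinarith
  refine ⟨∑ i ∈ Finset.range (p.natDegree + 1), monomial (m - e * i).toNat (p.coeff i), ?_, ?_⟩
  · rw [aeval_eq_sum_range, map_sum, Finset.mul_sum]
    refine Finset.sum_congr rfl fun i h' => ?_
    rw [toLaurent_C_mul_T, Int.toNat_of_nonneg (by have := hi i h'; omega),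
      LaurentPolynomial.T_pow, LaurentPolynomial.smul_eq_C_mul, mul_left_comm,
      ← LaurentPolynomial.T_add]
    congr 2; ring
  · rintro rfl
    rw [finsetSum_coeff, Finset.sum_eq_single p.natDegree]
    · simp
    · intro i h' hne
      rw [coeff_monomial, if_neg]
      have : i < p.natDegree := by have := Finset.mem_range.1 h'; omega
      have : 0 < (e : ℤ) * (p.natDegree - i) := by
        apply mul_pos <;> omega
      rw [← mul_sub]; omega
    · simp

/-- The homogeneous pieces of an element can be read off from a grading homomorphism `θ`. -/
lemma coeff_grading_aeval {k A σ : Type*} [CommRing k] [CommRing A] [Algebra k A]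
    {g : σ → A} {w : σ → ℕ} {θ : A →ₐ[k] A[X]} (hθ : ∀ i, θ (g i) = monomial (w i) (g i))
    (F : MvPolynomial σ k) (n : ℕ) :
    (θ (MvPolynomial.aeval g F)).coeff n =
      MvPolynomial.aeval g (MvPolynomial.weightedHomogeneousComponent w n F) := by
  classical
  have key : ∀ G : MvPolynomial σ k, ∀ m, G.IsWeightedHomogeneous w m →
      θ (MvPolynomial.aeval g G) = monomial m (MvPolynomial.aeval g G) := by
    intro G m hG
    have h1 : θ (MvPolynomial.aeval g G) =
        MvPolynomial.aeval (fun i => (X : A[X]) ^ w i * C (g i)) G := by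
      rw [MvPolynomial.comp_aeval_apply]
      congr 2; funext i
      rw [hθ, ← C_mul_X_pow_eq_monomial, mul_comm]
    have h2 : C (MvPolynomial.aeval g G) = MvPolynomial.aeval (fun i => C (g i)) G := by
      exact MvPolynomial.comp_aeval_apply (φ := (CAlgHom : A →ₐ[k] A[X])) g G
    rw [h1, hG.aeval_pow_mul, ← h2, ← C_mul_X_pow_eq_monomial, mul_comm]
  induction F using MvPolynomial.induction_on' with
  | add p q hp hq => simp only [map_add, coeff_add, hp, hq]
  | monomial d r =>
    have hd := MvPolynomial.isWeightedHomogeneous_monomial (R := k) w d r rfl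
    rw [key _ _ hd, coeff_monomial,
      MvPolynomial.weightedHomogeneousComponent_of_mem
        ((MvPolynomial.mem_weightedHomogeneousSubmodule k w _ _).2 hd)]
    by_cases h : Finsupp.weight w d = n
    · rw [if_pos h, if_pos h.symm]
    · rw [if_neg h, if_neg (Ne.symm h), map_zero]

/-- A family of nonconstant polynomials has a largest slope of the given degrees against the
exponent, here `N / e`. -/
lemma exists_max_slope {A σ : Type*} [CommRing A] [Fintype σ] (p : σ → A[X]) (w : σ → ℕ)
    (ω : A → ℕ) (hne : ∃ i, 0 < (p i).natDegree) :
    ∃ (i₀ : σ) (e : ℕ), e ≠ 0 ∧ (p i₀).coeff e ≠ 0 ∧ ∀ i j, j ≠ 0 → (p i).coeff j ≠ 0 →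
      (e : ℤ) * (ω ((p i).coeff j) - w i) ≤ (ω ((p i₀).coeff e) - w i₀) * j := by
  classical
  let s : Finset (Σ _ : σ, ℕ) := Finset.univ.sigma fun i => (p i).support.erase 0
  have hs : s.Nonempty := by
    obtain ⟨i, hi⟩ := hne
    refine ⟨⟨i, (p i).natDegree⟩, ?_⟩
    have : p i ≠ 0 := by rintro h; simp [h] at hi
    simp [s, hi.ne', this]
  obtain ⟨⟨i₀, e⟩, hmem, hmax⟩ := s.exists_max_image
    (fun x => ((ω ((p x.1).coeff x.2) : ℚ) - w x.1) / x.2) hs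
  simp only [s, Finset.mem_sigma, Finset.mem_univ, true_and, Finset.mem_erase, mem_support_iff]
    at hmem
  refine ⟨i₀, e, hmem.1, hmem.2, fun i j hj hc => ?_⟩
  have h := hmax ⟨i, j⟩ (by simp [s, hj, hc])
  have he' : (0 : ℚ) < e := by exact_mod_cast Nat.pos_of_ne_zero hmem.1
  have hj' : (0 : ℚ) < j := by exact_mod_cast Nat.pos_of_ne_zero hj
  simp only at h
  rw [div_le_div_iff₀ hj' he'] at h
  have h : (((ω ((p i).coeff j) : ℤ) - w i) * e) ≤ ((ω ((p i₀).coeff e) : ℤ) - w i₀) * j := by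
    exact_mod_cast h
  linarith

/-- Homogenization of a homomorphism `φ : A → A[U]` on a graded algebra. The variable `U` is given the
largest (rational) weight for which no monomial of `φ (g i)` exceeds the weight of `g i`, and `x i`
is the sum of the monomials that attain it. These top forms satisfy the homogeneous relations
between the `g i`, and the top form of an invariant of `φ` is invariant under `g i ↦ x i`.

The proof clears the denominator `e` of the weight, uses a Laurent variable that counts negative
weights, and multiplies by a power of it, so that passing to top forms becomes evaluation at `0`. -/
theorem exists_homogenization {k A σ : Type*} [CommRing k] [CommRing A] [Algebra k A] [Fintype σ]
    {g : σ → A} {w : σ → ℕ} {θ : A →ₐ[k] A[X]} (hθ : ∀ i, θ (g i) = monomial (w i) (g i))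
    (hθ_inj : Function.Injective θ)
    (hg : ∀ i, g i ≠ 0) (hgen : Function.Surjective (MvPolynomial.aeval g : MvPolynomial σ k → A))
    (hone : ∀ a, (θ a).eval 1 = a)
    {φ : A →ₐ[k] A[X]} (hφ : ∀ i, (φ (g i)).coeff 0 = g i)
    (hne : ∃ i, 0 < (φ (g i)).natDegree) :
    ∃ x : σ → A[X], (∀ i, (x i).coeff 0 = g i) ∧ (∃ i, 0 < (x i).natDegree) ∧
      (∀ n (F : MvPolynomial σ k), F.IsWeightedHomogeneous w n → MvPolynomial.aeval g F = 0 →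
        MvPolynomial.aeval x F = 0) ∧
      ∀ f, φ f = C f → ∃ F : MvPolynomial σ k, F.IsWeightedHomogeneous w (θ f).natDegree ∧
        MvPolynomial.aeval g F = (θ f).leadingCoeff ∧
        MvPolynomial.aeval x F = C (θ f).leadingCoeff := by
  classical
  obtain ⟨i₀, e, he, hc₀, hmax⟩ :=
    exists_max_slope (fun i => φ (g i)) w (fun a => (θ a).natDegree) hne
  set N : ℤ := (θ ((φ (g i₀)).coeff e)).natDegree - w i₀ with hN
  -- `U` gets the weight `-N / e`
  let S := LaurentPolynomial A
  let θe : A →ₐ[k] S :=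
    ((aeval (LaurentPolynomial.T (-(e : ℤ)) : S)).restrictScalars k : A[X] →ₐ[k] S).comp θ
  let Ψ : A →ₐ[k] S[X] :=
    (((aeval (C (LaurentPolynomial.T N : S) * X) : S[X] →ₐ[S] S[X]).restrictScalars k).comp
      (mapAlgHom θe)).comp φ
  have hΨ : ∀ a j, (Ψ a).coeff j = θe ((φ a).coeff j) * LaurentPolynomial.T (N * j) := by
    intro a j
    have : Ψ a = ((φ a).map (θe : A →+* S)).comp (C (LaurentPolynomial.T N : S) * X) := by
      rfl
    rw [this, comp_C_mul_X_coeff, coeff_map, LaurentPolynomial.T_pow, mul_comm N]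
    rfl
  have hθ0 : ∀ a, a ≠ 0 → θ a ≠ 0 := fun a ha h => ha (hθ_inj (by simpa using h))
  -- `Λ` identifies the part without negative exponents, on which `ε` evaluates at `0`
  let Λ : A[X][X] →ₐ[k] S[X] := mapAlgHom (toLaurentAlg.restrictScalars k)
  have hΛ : Function.Injective Λ := map_injective _ toLaurent_injective
  have hΛc : ∀ p j, (Λ p).coeff j = toLaurent (p.coeff j) := fun p j => coeff_map _ _
  let ε : A[X][X] →ₐ[k] A[X] := mapAlgHom ((aeval (0 : A)).restrictScalars k)
  have hεc : ∀ p j, (ε p).coeff j = (p.coeff j).coeff 0 := fun p j => by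
    rw [coeff_zero_eq_aeval_zero]; exact coeff_map _ _
  have hτ : ∀ n : ℕ, C (LaurentPolynomial.T (n : ℤ) : S) = Λ (C X ^ n) := by
    intro n
    ext1 j
    rw [hΛc, ← C_pow, coeff_C, coeff_C]
    split_ifs <;> simp
  have hlift : ∀ i, ∃ q : A[X][X], Λ q = Λ (C X ^ (e * w i)) * Ψ (g i) ∧
      (q.coeff 0).coeff 0 = g i ∧ (i = i₀ → (q.coeff e).coeff 0 ≠ 0) := by
    intro i
    have : ∀ j, ∃ q : A[X], toLaurent q =
        LaurentPolynomial.T (e * w i : ℕ) * (Ψ (g i)).coeff j ∧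
        ((e * w i + N * j = e * (θ ((φ (g i)).coeff j)).natDegree) →
          q.coeff 0 = (θ ((φ (g i)).coeff j)).leadingCoeff) := by
      intro j
      obtain ⟨q, h1, h2⟩ := exists_toLaurent_eq_T_mul_aeval (θ ((φ (g i)).coeff j)) e he
        (e * w i + N * j) (by
          intro h
          rcases eq_or_ne j 0 with rfl | hj
          · rw [hφ, hθ, natDegree_monomial_eq _ (hg i)]; simp
          · have := hmax i j hj (fun h' => h (by rw [h', map_zero]))
            linarith)
      refine ⟨q, ?_, h2⟩
      rw [h1, hΨ, LaurentPolynomial.T_add]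
      push_cast
      rw [mul_comm (θe _), mul_assoc]
      rfl
    choose q hq1 hq2 using this
    have hmem : Λ (C X ^ (e * w i)) * Ψ (g i) ∈ lifts (toLaurent : A[X] →+* S) := by
      rw [lifts_iff_coeff_lifts]
      intro j
      rw [← hτ, coeff_C_mul]
      exact ⟨q j, hq1 j⟩
    obtain ⟨Q, hQ⟩ := (mem_lifts _).1 hmem
    have hQq : ∀ j, Q.coeff j = q j := by
      intro j
      apply toLaurent_injective
      rw [hq1, ← coeff_C_mul, hτ, ← hQ, coeff_map]
    refine ⟨Q, hQ, ?_, ?_⟩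
    · rw [hQq, hq2]
      · rw [hφ, hθ, leadingCoeff_monomial]
      · rw [hφ, hθ, natDegree_monomial_eq _ (hg i)]; simp
    · rintro rfl
      rw [hQq, hq2]
      · exact leadingCoeff_ne_zero.2 (hθ0 _ hc₀)
      · rw [hN]; ring
  choose q hq hq0 hqe using hlift
  have hΛF : ∀ n (F : MvPolynomial σ k), F.IsWeightedHomogeneous w n →
      Λ (MvPolynomial.aeval q F) = Λ (C X ^ (e * n)) * Ψ (MvPolynomial.aeval g F) := by
    intro n F hF
    rw [MvPolynomial.comp_aeval_apply, MvPolynomial.comp_aeval_apply, pow_mul, map_pow,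
      ← hF.aeval_pow_mul]
    congr 2; funext i
    rw [hq, pow_mul, map_pow]
  refine ⟨fun i => ε (q i), fun i => ?_, ⟨i₀, ?_⟩, ?_, ?_⟩
  · rw [hεc, hq0]
  · refine lt_of_lt_of_le (Nat.pos_of_ne_zero he) (le_natDegree_of_ne_zero ?_)
    rw [hεc]; exact hqe _ rfl
  · intro n F hF h0
    have : MvPolynomial.aeval q F = 0 := hΛ (by rw [hΛF n F hF, h0]; simp)
    rw [← MvPolynomial.comp_aeval_apply, this, map_zero]
  · intro f hf
    set n := (θ f).natDegree
    -- a lift of `f`; its components of weight above `n` vanish in `A` and are dropped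
    obtain ⟨G, hG⟩ := hgen f
    let F : ℕ → MvPolynomial σ k := fun i => MvPolynomial.weightedHomogeneousComponent w i G
    have hF : ∀ i, (F i).IsWeightedHomogeneous w i := fun i =>
      MvPolynomial.weightedHomogeneousComponent_isWeightedHomogeneous _ _
    have hFc : ∀ i, MvPolynomial.aeval g (F i) = (θ f).coeff i := fun i => by
      rw [← hG, coeff_grading_aeval hθ]
    have hsum : ∑ i ∈ Finset.range (n + 1), MvPolynomial.aeval g (F i) = f := by
      conv_rhs => rw [← hone f, eval_eq_sum_range]
      simp [hFc, n]
    obtain ⟨r, hr1, hr2⟩ := exists_toLaurent_eq_T_mul_aeval (θ f) e he (e * n) (fun _ => le_rfl)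
    have hΨf : Λ (C r) = Λ (C X ^ (e * n)) * Ψ f := by
      ext1 j
      rw [hΛc, ← hτ, coeff_C_mul, hΨ, hf, coeff_C, coeff_C]
      split_ifs with h
      · subst h
        rw [hr1]
        simp only [Nat.cast_zero, mul_zero, LaurentPolynomial.T_zero, mul_one, Nat.cast_mul]
        rfl
      · simp
    have key : ∑ i ∈ Finset.range (n + 1), C X ^ (e * (n - i)) * MvPolynomial.aeval q (F i) =
        C r := by
      apply hΛ
      rw [hΨf, map_sum]
      conv_rhs => rw [← hsum, map_sum, Finset.mul_sum]
      refine Finset.sum_congr rfl fun i hi => ?_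
      have hi := Finset.mem_range.1 hi
      rw [map_mul, hΛF i _ (hF i), ← mul_assoc, ← map_mul, ← pow_add, ← mul_add,
        Nat.sub_add_cancel (by omega)]
    refine ⟨F n, hF n, hFc n, ?_⟩
    have hεX : ε (C X) = 0 := by ext1 j; rw [hεc, coeff_C]; split_ifs <;> simp
    have := congrArg ε key
    rw [map_sum, Finset.sum_range_succ, Finset.sum_eq_zero, zero_add] at this
    · rw [Nat.sub_self, mul_zero, pow_zero, one_mul, MvPolynomial.comp_aeval_apply] at this
      rw [this]
      ext1 j
      rw [hεc, coeff_C, coeff_C]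
      split_ifs
      · exact hr2 rfl
      · simp
    · intro i hi
      have hi := Finset.mem_range.1 hi
      rw [map_mul, map_pow, hεX, zero_pow, zero_mul]
      exact mul_ne_zero he (by omega)

/-! ### Rings in which sums of two squares are anisotropic -/

/-- In `R`, a sum of two squares vanishes only if both squares do; for a field this means that `-1`
is not a square. -/
def SumTwoSqAnisotropic (R : Type*) [CommRing R] : Prop :=
  ∀ a b : R, a ^ 2 + b ^ 2 = 0 → a = 0 ∧ b = 0

lemma SumTwoSqAnisotropic.of_field {k : Type*} [Field k] (hk : ¬ ∃ i : k, i ^ 2 = -1) :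
    SumTwoSqAnisotropic k := by
  have key : ∀ a b : k, a ^ 2 + b ^ 2 = 0 → b = 0 := by
    intro a b h
    by_contra hb
    exact hk ⟨a / b, by field_simp; linear_combination h⟩
  exact fun a b h => ⟨key b a (by rwa [add_comm]), key a b h⟩

lemma SumTwoSqAnisotropic.of_injective {R S : Type*} [CommRing R] [CommRing S]
    (hS : SumTwoSqAnisotropic S) (f : R →+* S) (hf : Function.Injective f) :
    SumTwoSqAnisotropic R := by
  intro a b h
  have := hS (f a) (f b) (by rw [← map_pow, ← map_pow, ← map_add, h, map_zero])
  exact ⟨hf (by simpa using this.1), hf (by simpa using this.2)⟩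

lemma SumTwoSqAnisotropic.two_ne_zero {R : Type*} [CommRing R] [Nontrivial R]
    (hR : SumTwoSqAnisotropic R) : (2 : R) ≠ 0 := fun h =>
  one_ne_zero (hR 1 1 (by rw [← h]; norm_num)).1

/-- The leading coefficients of two squares cannot cancel. -/
lemma SumTwoSqAnisotropic.natDegree_eq_zero {R : Type*} [CommRing R]
    (hR : SumTwoSqAnisotropic R) {a b : R[X]} (h : (a ^ 2 + b ^ 2).natDegree = 0) :
    a.natDegree = 0 ∧ b.natDegree = 0 := by
  set n := max a.natDegree b.natDegree with hn
  have ha : a.natDegree ≤ n := le_max_left _ _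
  have hb : b.natDegree ≤ n := le_max_right _ _
  rcases Nat.eq_zero_or_pos n with h0 | h0
  · omega
  exfalso
  have hc : a.coeff n ^ 2 + b.coeff n ^ 2 = 0 := by
    rw [← coeff_pow_of_natDegree_le ha, ← coeff_pow_of_natDegree_le hb, ← coeff_add]
    exact coeff_eq_zero_of_natDegree_lt (by rw [h]; omega)
  obtain ⟨h1, h2⟩ := hR _ _ hc
  rcases max_choice a.natDegree b.natDegree with h' | h' <;> rw [← hn] at h'
  · rw [h', coeff_natDegree, leadingCoeff_eq_zero] at h1
    rw [h1, natDegree_zero] at h'; omega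
  · rw [h', coeff_natDegree, leadingCoeff_eq_zero] at h2
    rw [h2, natDegree_zero] at h'; omega

lemma SumTwoSqAnisotropic.polynomial {R : Type*} [CommRing R] (hR : SumTwoSqAnisotropic R) :
    SumTwoSqAnisotropic R[X] := by
  intro a b h
  obtain ⟨ha, hb⟩ := hR.natDegree_eq_zero (by rw [h, natDegree_zero])
  rw [eq_C_of_natDegree_eq_zero ha, eq_C_of_natDegree_eq_zero hb] at h ⊢
  rw [← C_pow, ← C_pow, ← C_add, C_eq_zero] at h
  simpa using hR _ _ h

/-- A polynomial of odd degree is not a square, even up to squares. -/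
lemma eq_zero_of_sq_eq_mul_sq {R : Type*} [CommRing R] [IsDomain R] {h a b : R[X]}
    (hh : Odd h.natDegree) (e : a ^ 2 = h * b ^ 2) : b = 0 := by
  by_contra hb
  have h0 : h ≠ 0 := by rintro rfl; simp at hh
  have := congrArg natDegree e
  rw [natDegree_mul h0 (pow_ne_zero _ hb), natDegree_pow, natDegree_pow] at this
  obtain ⟨m, hm⟩ := hh
  omega

/-! ### The Pham–Brieskorn ring with exponents `2`, `2`, `c` -/

namespace PhamBrieskorn

variable {k : Type*} [Field k] {c : ℕ}

/-- The class of the `i`-th variable. -/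
noncomputable def gen (k : Type*) [Field k] (c : ℕ) (i : Fin 3) : PhamBrieskorn k ![2, 2, c] :=
  Ideal.Quotient.mk _ (MvPolynomial.X i)

lemma aeval_gen (F : MvPolynomial (Fin 3) k) :
    MvPolynomial.aeval (gen k c) F = Ideal.Quotient.mk _ F := by
  have : MvPolynomial.aeval (gen k c) =
      Ideal.Quotient.mkₐ k (Ideal.span {∑ i : Fin 3,
        (MvPolynomial.X i : MvPolynomial (Fin 3) k) ^ (![2, 2, c] : Fin 3 → ℕ) i}) := by
    ext i; simp [gen]
  rw [this]; rfl

lemma aeval_gen_surjective :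
    Function.Surjective
      (MvPolynomial.aeval (gen k c) : MvPolynomial (Fin 3) k → PhamBrieskorn k ![2, 2, c]) := by
  intro b
  obtain ⟨F, rfl⟩ := Ideal.Quotient.mk_surjective b
  exact ⟨F, aeval_gen F⟩

lemma relation : gen k c 0 ^ 2 + gen k c 1 ^ 2 + gen k c 2 ^ c = 0 := by
  simp only [gen, ← map_pow, ← map_add]
  rw [Ideal.Quotient.eq_zero_iff_mem]
  apply Ideal.subset_span
  simp [Fin.sum_univ_three]

lemma algHom_ext {A : Type*} [CommRing A] [Algebra k A] {f g : PhamBrieskorn k ![2, 2, c] →ₐ[k] A}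
    (h : ∀ i, f (gen k c i) = g (gen k c i)) : f = g := by
  refine AlgHom.ext fun b => ?_
  obtain ⟨F, rfl⟩ := aeval_gen_surjective b
  rw [MvPolynomial.comp_aeval_apply, MvPolynomial.comp_aeval_apply]
  simp only [h]

/-- A solution of the defining equation in `A` defines a homomorphism to `A`. -/
noncomputable def lift {A : Type*} [CommRing A] [Algebra k A] (x : Fin 3 → A)
    (hx : x 0 ^ 2 + x 1 ^ 2 + x 2 ^ c = 0) : PhamBrieskorn k ![2, 2, c] →ₐ[k] A :=
  Ideal.Quotient.liftₐ _ (MvPolynomial.aeval x) (by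
    intro a ha
    rw [← RingHom.mem_ker]
    refine (Ideal.span_le.2 ?_ : _ ≤ RingHom.ker (MvPolynomial.aeval x : _ →ₐ[k] A)) ha
    rintro _ rfl
    simpa [Fin.sum_univ_three, RingHom.mem_ker] using hx)

@[simp] lemma lift_gen {A : Type*} [CommRing A] [Algebra k A] (x : Fin 3 → A)
    (hx : x 0 ^ 2 + x 1 ^ 2 + x 2 ^ c = 0) (i : Fin 3) : lift (k := k) x hx (gen k c i) = x i := by
  simp only [gen, lift]
  rw [Ideal.Quotient.liftₐ_apply]
  exact (Ideal.Quotient.lift_mk _ _ _).trans (MvPolynomial.aeval_X _ _)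

/-- The ring `k[Y, Z][√-(Y² + Z^c)]`, with `Y` the inner and `Z` the outer variable. The
Pham–Brieskorn ring is isomorphic to it, with `X` as the square root. -/
abbrev Model (k : Type*) [Field k] (c : ℕ) : Type _ :=
  QuadraticAlgebra k[X][X] (-(C X ^ 2 + X ^ c)) 0

lemma odd_natDegree (hc : Odd c) : Odd (C X ^ 2 + X ^ c : k[X][X]).natDegree := by
  have : (C X ^ 2 + X ^ c : k[X][X]).natDegree = c := by
    rw [← C_pow, natDegree_C_add, natDegree_X_pow]
  rwa [this]

/-- The model has no zero divisors because its norm form is anisotropic: `-(Y² + Z^c)` has odd degree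
in `Z` and cannot be a quotient of squares. -/
lemma Model.norm_eq_zero (hc : Odd c) {z : Model k c} (h : z.norm = 0) : z = 0 := by
  rw [QuadraticAlgebra.norm_def] at h
  have him : z.im = 0 := eq_zero_of_sq_eq_mul_sq (h := -(C X ^ 2 + X ^ c)) (a := z.re)
    (by rw [natDegree_neg]; exact odd_natDegree hc) (by linear_combination h)
  ext1
  · simpa [him] using h
  · exact him

lemma Model.isDomain (hc : Odd c) : IsDomain (Model k c) := by
  have : NoZeroDivisors (Model k c) := by
    refine ⟨fun {a b} h => ?_⟩
    have := congrArg QuadraticAlgebra.norm h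
    rw [map_mul, QuadraticAlgebra.norm_zero, mul_eq_zero] at this
    exact this.imp (Model.norm_eq_zero hc) (Model.norm_eq_zero hc)
  exact NoZeroDivisors.to_isDomain _

lemma Model.sumTwoSqAnisotropic (hc : Odd c) (hk : SumTwoSqAnisotropic k) :
    SumTwoSqAnisotropic (Model k c) := by
  have hR : SumTwoSqAnisotropic k[X][X] := hk.polynomial.polynomial
  intro z w h
  have hre := congrArg QuadraticAlgebra.re h
  have him := congrArg QuadraticAlgebra.im h
  simp only [pow_two (M := Model k c), QuadraticAlgebra.re_add, QuadraticAlgebra.im_add,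
    QuadraticAlgebra.re_mul, QuadraticAlgebra.im_mul, QuadraticAlgebra.re_zero,
    QuadraticAlgebra.im_zero] at hre him
  have him' : z.re * z.im + w.re * w.im = 0 := by
    have : (2 : k[X][X]) * (z.re * z.im + w.re * w.im) = 0 := by linear_combination him
    exact (mul_eq_zero.1 this).resolve_left hR.two_ne_zero
  -- Brahmagupta's identity writes the norm of the imaginary parts as an impossible square.
  have hn : z.im ^ 2 + w.im ^ 2 = 0 := by
    refine eq_zero_of_sq_eq_mul_sq (a := z.re * w.im - w.re * z.im) (odd_natDegree (k := k) hc) ?_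
    linear_combination (z.im ^ 2 + w.im ^ 2) * hre - (z.re * z.im + w.re * w.im) * him'
  obtain ⟨h1, h2⟩ := hR _ _ hn
  obtain ⟨h3, h4⟩ := hR z.re w.re (by rw [h1, h2] at hre; linear_combination hre)
  exact ⟨QuadraticAlgebra.ext h3 h1, QuadraticAlgebra.ext h4 h2⟩

/-- The homomorphism to the model. -/
noncomputable def toModel (k : Type*) [Field k] (c : ℕ) :
    PhamBrieskorn k ![2, 2, c] →ₐ[k] Model k c :=
  lift ![⟨0, 1⟩, QuadraticAlgebra.C (C X), QuadraticAlgebra.C X] (by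
    simp only [Matrix.cons_val, ← QuadraticAlgebra.C_pow]
    ext1 <;> simp [pow_two, -QuadraticAlgebra.C_eq_algebraMap, -QuadraticAlgebra.C_pow,
      QuadraticAlgebra.re_C, QuadraticAlgebra.im_C])

lemma toModel_injective : Function.Injective (toModel k c) := by
  -- `r` is a left inverse, given by `Y`, `Z` and the square root `X`
  let ρ : k[X][X] →ₐ[k] PhamBrieskorn k ![2, 2, c] :=
    eval₂AlgHom (aeval (gen k c 1)) (gen k c 2) (fun _ => Commute.all _ _)
  have hρ : ρ (-(C X ^ 2 + X ^ c)) = gen k c 0 ^ 2 := by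
    simp only [map_neg, map_add, map_pow]
    have h1 : ρ (C X) = gen k c 1 := by simp [ρ]
    have h2 : ρ X = gen k c 2 := by simp [ρ]
    rw [h1, h2]
    linear_combination -relation (k := k) (c := c)
  let r : Model k c →ₐ[k] PhamBrieskorn k ![2, 2, c] :=
    { toFun := fun z => ρ z.re + ρ z.im * gen k c 0
      map_one' := by simp [QuadraticAlgebra.re_one, QuadraticAlgebra.im_one]
      map_zero' := by simp
      map_add' := fun z w => by simp; ring
      map_mul' := fun z w => by
        simp only [QuadraticAlgebra.re_mul, QuadraticAlgebra.im_mul, map_add, map_mul, hρ, map_zero]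
        ring
      commutes' := fun a => by
        have : algebraMap k (Model k c) a = ⟨algebraMap k k[X][X] a, 0⟩ := rfl
        rw [this]
        simp only [map_zero, zero_mul, add_zero, AlgHom.commutes] }
  have : r.comp (toModel k c) = AlgHom.id k _ := by
    apply algHom_ext
    intro i
    rw [AlgHom.comp_apply, toModel, lift_gen]
    change ρ _ + ρ _ * _ = _
    fin_cases i <;> simp [ρ]
  exact Function.LeftInverse.injective (g := r) fun b => DFunLike.congr_fun this b

lemma isDomain (hc : Odd c) : IsDomain (PhamBrieskorn k ![2, 2, c]) :=
  have := Model.isDomain (k := k) hc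
  toModel_injective.isDomain (toModel k c).toRingHom

lemma sumTwoSqAnisotropic (hc : Odd c) (hk : SumTwoSqAnisotropic k) :
    SumTwoSqAnisotropic (PhamBrieskorn k ![2, 2, c]) :=
  (Model.sumTwoSqAnisotropic hc hk).of_injective (toModel k c).toRingHom toModel_injective

lemma gen_ne_zero (i : Fin 3) : gen k c i ≠ 0 := by
  intro h
  have h := congrArg (toModel k c) h
  rw [toModel, lift_gen, map_zero] at h
  have h1 := congrArg QuadraticAlgebra.re h
  have h2 := congrArg QuadraticAlgebra.im h
  fin_cases i <;> simp at h1 h2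

/-- Extension of the ground field. -/
noncomputable def baseChange (k K : Type*) [Field k] [Field K] [Algebra k K] (c : ℕ) :
    PhamBrieskorn k ![2, 2, c] →ₐ[k] PhamBrieskorn K ![2, 2, c] :=
  lift (gen K c) relation

lemma baseChange_injective {K : Type*} [Field K] [Algebra k K] :
    Function.Injective (baseChange k K c) := by
  let f : k[X][X] →ₐ[k] K[X][X] := mapAlgHom (mapAlgHom (Algebra.ofId k K))
  have hf : Function.Injective f :=
    map_injective _ (map_injective _ (algebraMap k K).injective)
  have hfh : f (-(C X ^ 2 + X ^ c)) = -(C X ^ 2 + X ^ c) := by simp [f]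
  let μ : Model k c →ₐ[k] Model K c :=
    { toFun := fun z => ⟨f z.re, f z.im⟩
      map_one' := by ext1 <;> simp [QuadraticAlgebra.re_one, QuadraticAlgebra.im_one]
      map_zero' := by ext1 <;> simp
      map_add' := fun z w => by ext1 <;> simp
      map_mul' := fun z w => by
        ext1 <;>
        simp only [QuadraticAlgebra.re_mul, QuadraticAlgebra.im_mul, map_add, map_mul, hfh,
          map_zero]
      commutes' := fun a => by
        have h1 : algebraMap k (Model k c) a = ⟨algebraMap k k[X][X] a, 0⟩ := rfl
        have h2 : algebraMap k (Model K c) a = ⟨algebraMap k K[X][X] a, 0⟩ := rfl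
        rw [h1, h2]
        simp only [map_zero, AlgHom.commutes] }
  have hμ : Function.Injective μ := fun z w h =>
    QuadraticAlgebra.ext (hf (congrArg QuadraticAlgebra.re h))
      (hf (congrArg QuadraticAlgebra.im h))
  have : ((toModel K c).restrictScalars k).comp (baseChange k K c) = μ.comp (toModel k c) := by
    apply algHom_ext
    intro i
    simp only [AlgHom.comp_apply, baseChange, lift_gen, AlgHom.restrictScalars_apply, toModel]
    change _ = (⟨f _, f _⟩ : Model K c)
    fin_cases i <;> ext1 <;> simp [f]
  have h : Function.Injective (μ.comp (toModel k c)) := hμ.comp toModel_injective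
  rw [← this] at h
  exact Function.Injective.of_comp h

/-- The grading in which `X` and `Y` have degree `c` and `Z` has degree `2`, as a homomorphism that
multiplies an element of degree `d` by the `d`-th power of the variable. -/
noncomputable def grading (k : Type*) [Field k] (c : ℕ) :
    PhamBrieskorn k ![2, 2, c] →ₐ[k] (PhamBrieskorn k ![2, 2, c])[X] :=
  lift (fun i => monomial ((![c, c, 2] : Fin 3 → ℕ) i) (gen k c i)) (by
    simp only [monomial_pow, Matrix.cons_val]
    rw [mul_comm 2 c, ← map_add, ← map_add, relation, map_zero])

lemma grading_gen (i : Fin 3) :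
    grading k c (gen k c i) = monomial ((![c, c, 2] : Fin 3 → ℕ) i) (gen k c i) := by
  rw [grading, lift_gen]

lemma eval_one_grading (b : PhamBrieskorn k ![2, 2, c]) : (grading k c b).eval 1 = b := by
  have : (((aeval (1 : PhamBrieskorn k ![2, 2, c])).restrictScalars k).comp (grading k c)) =
      AlgHom.id k _ := by
    apply algHom_ext
    intro i
    simp [grading_gen]
  simpa [aeval_def, eval₂_eq_eval_map] using DFunLike.congr_fun this b

lemma grading_injective : Function.Injective (grading k c) :=
  Function.LeftInverse.injective (g := eval 1) eval_one_grading

end PhamBrieskorn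

/-! ### Invariants of exponential maps -/

/-- The leading coefficient of `φ a` is an invariant: compare the coefficients of the highest power
of `U` in `φ_V φ_U a = φ_{V + U} a`. -/
lemma IsExponentialMap.map_leadingCoeff {k A : Type*} [CommRing k] [CommRing A] [Algebra k A]
    {φ : A →ₐ[k] A[X]} (hφ : IsExponentialMap φ) (a : A) :
    φ (φ a).leadingCoeff = C (φ a).leadingCoeff := by
  have h := congrArg (fun p => p.coeff (φ a).natDegree) (hφ.map_map a)
  simp only [coeff_map, eval₂_eq_sum_range, finsetSum_coeff] at h
  rw [Finset.sum_range_succ, Finset.sum_eq_zero, zero_add] at h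
  · simpa [add_comm (C X : A[X][X]), coeff_X_add_C_pow, ← C_mul_X_pow_eq_monomial] using h
  · intro j hj
    have hj := Finset.mem_range.1 hj
    rw [RingHom.comp_apply, coeff_C_mul, add_comm (C X : A[X][X]), coeff_X_add_C_pow,
      Nat.choose_eq_zero_of_lt hj]
    simp

/-- An exponential map whose only invariants are the scalars makes the algebra grow at most
linearly. -/
lemma IsExponentialMap.rank_le {k A : Type*} [Field k] [CommRing A] [Algebra k A]
    {φ : A →ₐ[k] A[X]} (hφ : IsExponentialMap φ)
    (h : ∀ f, φ f = C f → f ∈ (1 : Submodule k A)) (n : ℕ) :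
    Module.rank k (((degreeLT A n).restrictScalars k).comap φ.toLinearMap) ≤ n := by
  set V : ℕ → Submodule k A := fun n => ((degreeLT A n).restrictScalars k).comap φ.toLinearMap
   
  have hmem : ∀ n a, a ∈ V n ↔ (φ a).degree < n := fun n a => mem_degreeLT
  change Module.rank k (V n) ≤ n
  induction n with
  | zero =>
    have : V 0 = ⊥ := by
      rw [eq_bot_iff]
      intro a ha
      have h0 : φ a = 0 := by simpa using (hmem 0 a).1 ha
      rw [Submodule.mem_bot, ← hφ.eval_zero a, h0, Polynomial.eval_zero]
    rw [this]; simp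
  | succ n ih =>
    let l : V (n + 1) →ₗ[k] A :=
      (((lcoeff A n).restrictScalars k).comp φ.toLinearMap).comp (V (n + 1)).subtype
    have hl : ∀ a, l a = (φ a).coeff n := fun a => rfl
    have hrange : Module.rank k (LinearMap.range l) ≤ 1 := by
      have h1 : LinearMap.range l ≤ (1 : Submodule k A) := by
        rintro _ ⟨a, rfl⟩
        rw [hl]
        by_cases h0 : (φ a).coeff n = 0
        · rw [h0]; exact zero_mem _
        · have hn : (φ (a : A)).natDegree = n := by
            refine le_antisymm ?_ (le_natDegree_of_ne_zero h0)
            have h1 : φ (a : A) ≠ 0 := fun h1 => h0 (by rw [h1, coeff_zero])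
            exact Nat.lt_succ_iff.1 ((natDegree_lt_iff_degree_lt h1).2 ((hmem _ _).1 a.2))
          have := hφ.map_leadingCoeff (a : A)
          rw [leadingCoeff, hn] at this
          exact h _ this
      refine (Submodule.rank_mono h1).trans ?_
      rw [Submodule.one_eq_span]
      exact (rank_span_le _).trans (by simp)
    have hker : Module.rank k (LinearMap.ker l) ≤ n := by
      refine le_trans ?_ ih
      refine (LinearEquiv.rank_eq ((LinearMap.ker l).equivMapOfInjective _
        (V (n + 1)).injective_subtype)).le.trans (Submodule.rank_mono ?_)
      rintro _ ⟨a, ha, rfl⟩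
      rw [hmem, degree_lt_iff_coeff_zero]
      intro m hm
      rcases hm.eq_or_lt with rfl | hm
      · exact ha
      · exact coeff_eq_zero_of_degree_lt (((hmem _ _).1 a.2).trans_le (by exact_mod_cast hm))
    rw [← LinearMap.rank_range_add_rank_ker l, add_comm]
    push_cast
    exact add_le_add hker hrange

/-- An algebra with two algebraically independent elements grows at least quadratically, so an
exponential map on it has an invariant that is not a scalar. -/
theorem IsExponentialMap.exists_invariant {k A : Type*} [Field k] [CommRing A] [Algebra k A]
    {φ : A →ₐ[k] A[X]} (hφ : IsExponentialMap φ) {y z : A}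
    (hyz : LinearIndependent k fun p : ℕ × ℕ => y ^ p.1 * z ^ p.2) :
    ∃ f, φ f = C f ∧ f ∉ (1 : Submodule k A) := by
  by_contra! h
  set D := max (φ y).natDegree (φ z).natDegree
  set M := 2 * D + 2 with hM
  have hrank := hφ.rank_le h (2 * M * D + 1)
  set V := ((degreeLT A (2 * M * D + 1)).restrictScalars k).comap φ.toLinearMap
  have hmem : ∀ p : Fin M × Fin M, y ^ (p.1 : ℕ) * z ^ (p.2 : ℕ) ∈ V := by
    intro p
    refine mem_degreeLT.2 (degree_le_natDegree.trans_lt ?_)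
    rw [Nat.cast_lt, Nat.lt_succ_iff]
    change (φ _).natDegree ≤ _
    rw [map_mul, map_pow, map_pow]
    refine natDegree_mul_le.trans ?_
    have h1 : (φ y ^ (p.1 : ℕ)).natDegree ≤ M * D :=
      natDegree_pow_le.trans (Nat.mul_le_mul p.1.2.le (le_max_left _ _))
    have h2 : (φ z ^ (p.2 : ℕ)).natDegree ≤ M * D :=
      natDegree_pow_le.trans (Nat.mul_le_mul p.2.2.le (le_max_right _ _))
    linarith
  have hli : LinearIndependent k fun p : Fin M × Fin M => (⟨_, hmem p⟩ : V) := by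
    apply LinearIndependent.of_comp V.subtype
    exact hyz.comp (fun p : Fin M × Fin M => ((p.1 : ℕ), (p.2 : ℕ))) fun p q h => by
      simp only [Prod.mk.injEq] at h
      exact Prod.ext (Fin.ext h.1) (Fin.ext h.2)
  have hcard := hli.cardinal_lift_le_rank
  have hle : ((M * M : ℕ) : Cardinal) ≤ ((2 * M * D + 1 : ℕ) : Cardinal) := by
    have h2 := Cardinal.lift_le.{0}.2 hrank
    simp only [Cardinal.mk_prod, Cardinal.mk_fin, Cardinal.lift_id, Cardinal.lift_mul,
      Cardinal.lift_natCast, Cardinal.lift_uzero] at hcard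
    push_cast at hrank ⊢
    exact hcard.trans hrank
  have hle : M * M ≤ 2 * M * D + 1 := by exact_mod_cast hle
  nlinarith

namespace PhamBrieskorn

variable {k : Type*} [Field k] {c : ℕ}

lemma linearIndependent_gen :
    LinearIndependent k fun p : ℕ × ℕ => gen k c 1 ^ p.1 * gen k c 2 ^ p.2 := by
  have h : LinearIndependent k fun p : ℕ × ℕ => (C X ^ p.1 * X ^ p.2 : k[X][X]) := by
    rw [linearIndependent_iff']
    intro s g hg p hp
    have := congrArg (fun q => (q.coeff p.2).coeff p.1) hg
    simp only [finsetSum_coeff, coeff_smul, ← C_pow, coeff_C_mul, coeff_X_pow, coeff_zero] at this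
    rw [Finset.sum_eq_single p] at this
    · simpa using this
    · intro q _ hq
      by_cases h2 : p.2 = q.2
      · have h1 : p.1 ≠ q.1 := fun h1 => hq (Prod.ext h1.symm h2.symm)
        simp [h2, coeff_X_pow, h1]
      · simp [h2]
    · exact fun h => (h hp).elim
  apply LinearIndependent.of_comp (toModel k c).toLinearMap
  have h' := h.map' ((Algebra.linearMap k[X][X] (Model k c)).restrictScalars k)
    (LinearMap.ker_eq_bot.2 QuadraticAlgebra.algebraMap_injective)
  have : (toModel k c).toLinearMap ∘ (fun p : ℕ × ℕ => gen k c 1 ^ p.1 * gen k c 2 ^ p.2) =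
      ((Algebra.linearMap k[X][X] (Model k c)).restrictScalars k) ∘
        fun p => C X ^ p.1 * X ^ p.2 := by
    funext p
    simp [toModel]
  rw [this]
  exact h'

end PhamBrieskorn

/-! ### Forms and Fermat–Catalan equations over polynomial rings -/

/-- If a nonzero form of positive degree takes a nonzero constant value at `(x, y)`, then one of its
linear factors does. -/
lemma exists_linear_form_natDegree_eq_zero {K R : Type*} [Field K] [IsAlgClosed K] [CommRing R]
    [IsDomain R] [Algebra K R] {x y : R[X]} {m : ℕ} (hm : m ≠ 0) {H : MvPolynomial (Fin 2) K}
    (hH : H.IsHomogeneous m) {b : R} (hb : b ≠ 0) (h : MvPolynomial.aeval ![x, y] H = C b) :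
    ∃ α β : K, (α ≠ 0 ∨ β ≠ 0) ∧ (α • x + β • y).natDegree = 0 := by
  set g : K[X] := MvPolynomial.aeval ![X, 1] H with hg
  have hgH : g.homogenize m = H := homogenize_eq_of_isHomogeneous hH rfl
  have hgm : g.natDegree ≤ m := by
    rw [hg, H.as_sum, map_sum]
    refine natDegree_sum_le_of_forall_le _ _ fun s hs => ?_
    have hs' : s.weight 1 = m := hH (by simpa using hs)
    rw [MvPolynomial.aeval_monomial, ← C_eq_algebraMap]
    simp only [Finsupp.prod_fintype, Fin.prod_univ_two, Matrix.cons_val, one_pow, mul_one,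
      pow_zero, implies_true]
    refine (natDegree_C_mul_X_pow_le _ _).trans ?_
    simp [Finsupp.weight_apply, Finsupp.sum_fintype, Fin.sum_univ_two] at hs'
    omega
  have hCb : (C b : R[X]) ≠ 0 := C_ne_zero.2 hb
  by_cases hdeg : g.degree = 0
  · refine ⟨0, 1, Or.inr one_ne_zero, ?_⟩
    rw [eq_C_of_degree_eq_zero hdeg, homogenize_C] at hgH
    rw [← hgH] at h
    simp only [map_mul, map_pow, MvPolynomial.aeval_X, Matrix.cons_val] at h
    have h0 := h ▸ hCb
    have := congrArg natDegree h
    rw [natDegree_mul (left_ne_zero_of_mul h0) (right_ne_zero_of_mul h0), natDegree_pow,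
      natDegree_C] at this
    have := Nat.eq_zero_of_add_eq_zero_left this
    simpa [hm] using this
  · obtain ⟨r, hr⟩ := IsAlgClosed.exists_root g hdeg
    obtain ⟨q, hq⟩ := dvd_iff_isRoot.2 hr
    have hg0 : g ≠ 0 := by
      rintro h0
      rw [← hgH, h0, homogenize_zero, map_zero] at h
      exact hCb h.symm
    have hq0 : q ≠ 0 := by rintro rfl; exact hg0 (by rw [hq, mul_zero])
    have hqm : q.natDegree ≤ m - 1 := by
      rw [hq, natDegree_mul (X_sub_C_ne_zero r) hq0, natDegree_X_sub_C] at hgm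
      omega
    have hfac : H = (X - C r).homogenize 1 * q.homogenize (m - 1) := by
      rw [← homogenize_mul _ _ (natDegree_X_sub_C r).le hqm, ← hq, ← hgH]
      congr 1; omega
    refine ⟨1, -r, Or.inl one_ne_zero, ?_⟩
    rw [hfac, map_mul] at h
    have h0 := h ▸ hCb
    have := congrArg natDegree h
    rw [natDegree_mul (left_ne_zero_of_mul h0) (right_ne_zero_of_mul h0), natDegree_C] at this
    have := Nat.eq_zero_of_add_eq_zero_right this
    rw [homogenize_sub, homogenize_X one_ne_zero, homogenize_C] at this
    simpa [Algebra.smul_def, sub_eq_add_neg] using this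

/-- In characteristic dividing `c`, a derivation of the coefficients that does not kill `w` kills
`a z ^ c` and hence turns `s ^ 2 + w ^ 2 + a z ^ c = 0` into a factorization of a constant. -/
lemma natDegree_eq_zero_of_derivation {A : Type*} [CommRing A] [IsDomain A] (D : Derivation ℤ A A)
    (h2 : (2 : A) ≠ 0) {c : ℕ} (hc : (c : A) = 0) {s z : A[X]} {w a : A} (ha : D a = 0)
    (hw : w ≠ 0) (hDw : D w ≠ 0) (h : s ^ 2 + C w ^ 2 + C a * z ^ c = 0) : s.natDegree = 0 := by
  let _ : Differential A := ⟨D⟩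
  have hC : ∀ r : A, Differential.mapCoeffs (C r) = C (D r) := Differential.mapCoeffs_C
  have hd := congrArg (Differential.mapCoeffs (A := A)) h
  have hc' : (c : A[X]) = 0 := by rw [← map_natCast C, hc, C_0]
  simp only [map_add, map_zero, Derivation.leibniz, Derivation.leibniz_pow, smul_eq_mul, hC, ha,
    nsmul_eq_mul, hc', mul_zero, zero_mul, add_zero, Nat.add_one_sub_one, pow_one,
    Nat.cast_ofNat] at hd
  have h2' : (2 : A[X]) ≠ 0 := by
    rw [← C_ofNat]; exact C_ne_zero.2 h2
  have hd : s * Differential.mapCoeffs s = C (-(w * D w)) := by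
    apply mul_left_cancel₀ h2'
    rw [C_neg, C_mul]
    linear_combination hd
  have h0 : s * Differential.mapCoeffs s ≠ 0 := by
    rw [hd]; exact C_ne_zero.2 (neg_ne_zero.2 (mul_ne_zero hw hDw))
  have := congrArg natDegree hd
  rw [natDegree_mul (left_ne_zero_of_mul h0) (right_ne_zero_of_mul h0), natDegree_C] at this
  omega

/-- In characteristic prime to `c` (and to `2`), the equation `s ^ 2 + w ^ 2 + a z ^ c = 0` with
constant `w ≠ 0` is of Fermat–Catalan type with exponents `2`, `c` and any `r`, as
`w ^ 2 = w ^ 2 * 1 ^ r`. -/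
lemma natDegree_eq_zero_of_catalan {A : Type*} [CommRing A] [IsDomain A]
    (h2 : (2 : A) ≠ 0) {c : ℕ} (hc3 : 3 ≤ c) (hc : (c : A) ≠ 0) {s z : A[X]} {w a : A}
    (ha : a ≠ 0) (hw : w ≠ 0) (h : s ^ 2 + C w ^ 2 + C a * z ^ c = 0) : s.natDegree = 0 := by
  classical
  let F := FractionRing A
  have hinj : Function.Injective (algebraMap A F) := IsFractionRing.injective A F
  have hmap : ∀ {r : A}, r ≠ 0 → algebraMap A F r ≠ 0 := fun hr =>
    (map_ne_zero_iff _ hinj).2 hr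
  have hs : (s.map (algebraMap A F)).natDegree = s.natDegree := natDegree_map_eq_of_injective hinj s
  rw [← hs]
  set S := s.map (algebraMap A F)
  set Z := z.map (algebraMap A F)
  set W := algebraMap A F w
  set a' := algebraMap A F a
  have hW : W ≠ 0 := hmap hw
  have hF : S ^ 2 + C W ^ 2 + C a' * Z ^ c = 0 := by
    have := congrArg (map (algebraMap A F)) h
    simpa using this
  have hcop : IsCoprime S Z := by
    refine ⟨-C (W⁻¹ ^ 2) * S, -C (W⁻¹ ^ 2) * C a' * Z ^ (c - 1), ?_⟩
    have h1 : (C W⁻¹ * C W : F[X]) = 1 := by rw [← C_mul, inv_mul_cancel₀ hW, C_1]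
    have h3 : Z ^ c = Z ^ (c - 1) * Z := by rw [← pow_succ]; congr 1; omega
    rw [h3] at hF
    rw [C_pow]
    linear_combination (-C W⁻¹ ^ 2) * hF + (C W⁻¹ * C W + 1) * h1
  by_cases hS : S = 0
  · rw [hS, natDegree_zero]
  by_cases hZ : Z = 0
  · have : S ^ 2 = C (-W ^ 2) := by
      rw [hZ, zero_pow (by omega)] at hF
      rw [C_neg, C_pow]
      linear_combination hF
    have := congrArg natDegree this
    rw [natDegree_pow, natDegree_C] at this
    omega
  have hFc : ((c : ℕ) : F) ≠ 0 := by
    rw [← map_natCast (algebraMap A F)]; exact hmap hc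
  have hF2 : (2 : F) ≠ 0 := by
    rw [← map_ofNat (algebraMap A F)]; exact hmap h2
  -- the exponent `8` is large enough and prime to the characteristic
  have hF8 : ((8 : ℕ) : F) ≠ 0 := by
    have : ((8 : ℕ) : F) = 2 ^ 3 := by norm_num
    rw [this]; exact pow_ne_zero _ hF2
  exact (flt_catalan (p := 2) (q := c) (r := 8) (by norm_num) (by omega) (by norm_num) (by omega)
    (by exact_mod_cast hF2) hFc hF8 hS hZ one_ne_zero hcop one_ne_zero (hmap ha)
    (pow_ne_zero 2 hW)
    (by rw [C_1, C_pow]; linear_combination hF)).1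

namespace PhamBrieskorn

variable {k : Type*} [Field k] {c : ℕ}

/-- The infinitesimal rotation in the variables `X` and `Y`. -/
lemma exists_rotation (K : Type*) [Field K] (c : ℕ) :
    ∃ D : Derivation K (PhamBrieskorn K ![2, 2, c]) (PhamBrieskorn K ![2, 2, c]),
      D (gen K c 0) = -gen K c 1 ∧ D (gen K c 1) = gen K c 0 := by
  let d : Derivation K (MvPolynomial (Fin 3) K) (MvPolynomial (Fin 3) K) :=
    MvPolynomial.mkDerivation K ![-MvPolynomial.X 1, MvPolynomial.X 0, 0]
  have hd : ∀ F, MvPolynomial.aeval (gen K c) F = 0 → MvPolynomial.aeval (gen K c) (d F) = 0 := by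
    intro F hF
    rw [aeval_gen, Ideal.Quotient.eq_zero_iff_mem, Ideal.mem_span_singleton] at hF
    obtain ⟨G, rfl⟩ := hF
    have h0 : d (∑ i : Fin 3, MvPolynomial.X i ^ (![2, 2, c] : Fin 3 → ℕ) i) = 0 := by
      simp [Fin.sum_univ_three, d, MvPolynomial.mkDerivation_X, Derivation.leibniz_pow]
      ring
    rw [Derivation.leibniz, h0, smul_zero, add_zero, smul_eq_mul, map_mul]
    have : MvPolynomial.aeval (gen K c)
        (∑ i : Fin 3, (MvPolynomial.X i : MvPolynomial (Fin 3) K) ^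
          (![2, 2, c] : Fin 3 → ℕ) i) = 0 := by
      simpa [Fin.sum_univ_three] using relation (k := K) (c := c)
    rw [this, zero_mul]
  let D := Derivation.liftOfSurjective (aeval_gen_surjective (k := K) (c := c)) hd
  have hD : ∀ i, D (gen K c i) = MvPolynomial.aeval (gen K c) (d (MvPolynomial.X i)) := by
    intro i
    rw [← Derivation.liftOfSurjective_apply (aeval_gen_surjective (k := K) (c := c)) hd,
      MvPolynomial.aeval_X]
  exact ⟨D, by rw [hD]; simp [d, MvPolynomial.mkDerivation_X], by
    rw [hD]; simp [d, MvPolynomial.mkDerivation_X]⟩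

/-- `X` and `Y` are linearly independent, by evaluation at `(1, 0, -1)` and `(0, 1, -1)`. -/
lemma linear_form_gen_ne_zero (hc : Odd c) {α β : k} (h : α ≠ 0 ∨ β ≠ 0) :
    algebraMap k _ α * gen k c 0 + algebraMap k _ β * gen k c 1 ≠ 0 := by
  intro h0
  have h1 := congrArg (lift (k := k) (c := c) ![(1 : k), 0, -1] (by simp [hc.neg_one_pow])) h0
  have h2 := congrArg (lift (k := k) (c := c) ![(0 : k), 1, -1] (by simp [hc.neg_one_pow])) h0
  simp at h1 h2
  tauto

/-- Reducing `Z ^ c` to `-(X ^ 2 + Y ^ 2)` turns a weighted homogeneous element into a power of `Z`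
times a form in `X` and `Y`: since `c` is odd, the exponents of `Z` in the monomials of a given
weight agree modulo `c`. -/
lemma exists_eq_pow_mul_form (hc : Odd c) {F : MvPolynomial (Fin 3) k} {n : ℕ}
    (hF : F.IsWeightedHomogeneous (![c, c, 2] : Fin 3 → ℕ) n) (hF0 : F ≠ 0) :
    ∃ d m, 2 * d + c * m = n ∧ ∃ H : MvPolynomial (Fin 2) k, H.IsHomogeneous m ∧
      MvPolynomial.aeval (gen k c) F =
        gen k c 2 ^ d * MvPolynomial.aeval ![gen k c 0, gen k c 1] H := by
  have hcpos := hc.pos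
  have hw : ∀ s ∈ F.support, c * (s 0 + s 1) + 2 * s 2 = n := by
    intro s hs
    have := hF (MvPolynomial.mem_support_iff.1 hs)
    simp [Finsupp.weight_apply, Finsupp.sum_fintype, Fin.sum_univ_three] at this
    linarith
  obtain ⟨s₀, hs₀⟩ := MvPolynomial.support_nonempty.2 hF0
  set d := s₀ 2 % c
  set m := s₀ 0 + s₀ 1 + 2 * (s₀ 2 / c)
  have hdm : 2 * d + c * m = n := by
    rw [← hw s₀ hs₀]
    have := Nat.mod_add_div (s₀ 2) c
    simp only [m]
    calc 2 * d + c * (s₀ 0 + s₀ 1 + 2 * (s₀ 2 / c))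
        = c * (s₀ 0 + s₀ 1) + 2 * (s₀ 2 % c + c * (s₀ 2 / c)) := by ring
      _ = _ := by rw [this]
  refine ⟨d, m, hdm, ?_⟩
  let L : MvPolynomial (Fin 2) k →ₗ[k] PhamBrieskorn k ![2, 2, c] :=
    (LinearMap.mulLeft k (gen k c 2 ^ d)).comp
      (MvPolynomial.aeval ![gen k c 0, gen k c 1]).toLinearMap
  suffices h : MvPolynomial.aeval (gen k c) F ∈
      (MvPolynomial.homogeneousSubmodule (Fin 2) k m).map L by
    obtain ⟨H, hH, h⟩ := h
    exact ⟨H, hH, h.symm⟩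
  rw [F.as_sum, map_sum]
  refine Submodule.sum_mem _ fun s hs => ?_
  have hmod : s 2 % c = d := by
    have h1 : 2 * s 2 ≡ 2 * s₀ 2 [MOD c] := by
      have e : c * (s 0 + s 1) + 2 * s 2 = c * (s₀ 0 + s₀ 1) + 2 * s₀ 2 := by
        rw [hw s hs, hw s₀ hs₀]
      have := congrArg (· % c) e
      simpa [Nat.ModEq, Nat.add_mod] using this
    exact Nat.ModEq.cancel_left_of_coprime (by
      rw [Nat.gcd_comm]; exact Nat.coprime_two_left.2 hc) h1
  have hs2 : s 2 = d + c * (s 2 / c) := by rw [← hmod]; exact (Nat.mod_add_div _ _).symm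
  set l := s 2 / c
  have hdeg : s 0 + s 1 + 2 * l = m := by
    have := hw s hs
    rw [hs2, ← hdm] at this
    apply Nat.eq_of_mul_eq_mul_left hcpos
    linarith
  refine ⟨MvPolynomial.C (F.coeff s) * (MvPolynomial.X 0 ^ s 0 * MvPolynomial.X 1 ^ s 1 *
    (-(MvPolynomial.X 0 ^ 2 + MvPolynomial.X 1 ^ 2)) ^ l), ?_, ?_⟩
  · rw [SetLike.mem_coe, MvPolynomial.mem_homogeneousSubmodule, ← hdeg]
    have hX := fun i : Fin 2 => MvPolynomial.isHomogeneous_X k i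
    have h2 : (-(MvPolynomial.X 0 ^ 2 + MvPolynomial.X 1 ^ 2) :
        MvPolynomial (Fin 2) k).IsHomogeneous 2 :=
      (((by simpa using (hX 0).pow 2) : MvPolynomial.IsHomogeneous _ 2).add
        (by simpa using (hX 1).pow 2)).neg
    have := (((hX 0).pow (s 0)).mul ((hX 1).pow (s 1))).mul (h2.pow l)
    simp only [one_mul] at this
    exact this.C_mul _
  · have hrel : -(gen k c 0 ^ 2 + gen k c 1 ^ 2) = gen k c 2 ^ c := by
      linear_combination -relation (k := k) (c := c)
    have hL : ∀ G, L G = gen k c 2 ^ d * MvPolynomial.aeval ![gen k c 0, gen k c 1] G :=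
      fun _ => rfl
    rw [hL, MvPolynomial.aeval_monomial]
    simp only [map_mul, map_pow, map_neg, map_add, MvPolynomial.aeval_X, MvPolynomial.algHom_C,
      Matrix.cons_val, hrel, Finsupp.prod_fintype, Fin.prod_univ_three, pow_zero, implies_true]
    rw [hs2, pow_add, pow_mul]
    ring

end PhamBrieskorn

/-! ### Rigidity -/

namespace PhamBrieskorn

variable {k : Type*} [Field k] {c : ℕ}

/-- A polynomial curve on the surface through a point with coordinates `X`, `Y`, `Z`, along which a
form in `X` and `Y` is constant and nonzero, is constant. -/
lemma natDegree_eq_zero_of_form (K : Type*) [Field K] [IsAlgClosed K] [Algebra k K] (hc1 : 1 < c)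
    (hc : Odd c) (hk : SumTwoSqAnisotropic k)
    {x : Fin 3 → (PhamBrieskorn k ![2, 2, c])[X]} (hx0 : ∀ i, (x i).coeff 0 = gen k c i)
    (hrel : x 0 ^ 2 + x 1 ^ 2 + x 2 ^ c = 0) {m : ℕ} (hm : m ≠ 0)
    {H : MvPolynomial (Fin 2) k} (hH : H.IsHomogeneous m) {b : PhamBrieskorn k ![2, 2, c]}
    (hb : b ≠ 0) (h : MvPolynomial.aeval ![x 0, x 1] H = C b) :
    (x 0).natDegree = 0 ∧ (x 1).natDegree = 0 := by
  have := isDomain (k := k) hc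
  have := isDomain (k := K) hc
  let ι := baseChange k K c
  have hι : Function.Injective ι := baseChange_injective
  have hι_gen : ∀ i, ι (gen k c i) = gen K c i := fun i => lift_gen _ _ i
  let y : Fin 3 → (PhamBrieskorn K ![2, 2, c])[X] := fun i => mapAlgHom ι (x i)
  have hyc : ∀ i j, (y i).coeff j = ι ((x i).coeff j) := fun i j => coeff_map _ _
  have hy0 : ∀ i, (y i).coeff 0 = gen K c i := fun i => by rw [hyc, hx0, hι_gen]
  have hdeg : ∀ i, (y i).natDegree = (x i).natDegree := fun i => natDegree_map_eq_of_injective hι _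
  have hyrel : y 0 ^ 2 + y 1 ^ 2 + y 2 ^ c = 0 := by
    simp only [y, ← map_pow, ← map_add, hrel, map_zero]
  have hyH : MvPolynomial.aeval ![y 0, y 1] (MvPolynomial.map (algebraMap k K) H) = C (ι b) := by
    have h1 := MvPolynomial.comp_aeval_apply (B := (PhamBrieskorn K ![2, 2, c])[X])
      (f := ![x 0, x 1]) (mapAlgHom ι) H
    have h2 : (fun i => mapAlgHom ι (![x 0, x 1] i)) = ![y 0, y 1] := by
      funext i; fin_cases i <;> rfl
    rw [h2] at h1
    rw [MvPolynomial.aeval_map_algebraMap, ← h1, h]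
    exact map_C _
  obtain ⟨α, β, hαβ, hw⟩ := exists_linear_form_natDegree_eq_zero hm
    (hH.map (algebraMap k K)) ((map_ne_zero_iff ι hι).2 hb) hyH
  have hCsmul : ∀ (r : K) (p : (PhamBrieskorn K ![2, 2, c])[X]),
      r • p = C (algebraMap K _ r) * p := fun r p => by
    rw [Algebra.smul_def, Polynomial.algebraMap_apply]
  by_cases hq : α ^ 2 + β ^ 2 = 0
  · -- the linear form is isotropic, so that the forms `x_j ^ 2 + y_j ^ 2` vanish
    have hα : α ≠ 0 := by
      rintro rfl
      simp at hq
      simp [hq] at hαβ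
    have hcoeff : ∀ j, j ≠ 0 → (x 0).coeff j = 0 ∧ (x 1).coeff j = 0 := by
      intro j hj
      apply sumTwoSqAnisotropic hc hk
      apply hι
      have h1 : algebraMap K (PhamBrieskorn K ![2, 2, c]) α * (y 0).coeff j +
          algebraMap K _ β * (y 1).coeff j = 0 := by
        rw [← coeff_C_mul, ← coeff_C_mul, ← hCsmul, ← hCsmul, ← coeff_add]
        exact coeff_eq_zero_of_natDegree_lt (by rw [hw]; omega)
      rw [map_zero, map_add, map_pow, map_pow, ← hyc, ← hyc]
      have h2 : algebraMap K (PhamBrieskorn K ![2, 2, c]) α ^ 2 + algebraMap K _ β ^ 2 = 0 := by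
        rw [← map_pow, ← map_pow, ← map_add, hq, map_zero]
      have h3 : algebraMap K (PhamBrieskorn K ![2, 2, c]) α ^ 2 ≠ 0 :=
        pow_ne_zero _ ((map_ne_zero_iff _ (algebraMap K _).injective).2 hα)
      apply mul_left_cancel₀ h3
      rw [mul_zero]
      linear_combination (algebraMap K (PhamBrieskorn K ![2, 2, c]) α * (y 0).coeff j -
        algebraMap K _ β * (y 1).coeff j) * h1 + (y 1).coeff j ^ 2 * h2
    have hconst : ∀ i, (∀ j, j ≠ 0 → (x i).coeff j = 0) → (x i).natDegree = 0 := by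
      intro i hi
      by_contra h0
      have := hi _ h0
      rw [coeff_natDegree, leadingCoeff_eq_zero] at this
      rw [this, natDegree_zero] at h0
      exact h0 rfl
    exact ⟨hconst 0 fun j hj => (hcoeff j hj).1, hconst 1 fun j hj => (hcoeff j hj).2⟩
  · -- rotate `(x, y)` so that the constant linear form becomes one of the coordinates
    set w := algebraMap K _ α * gen K c 0 + algebraMap K _ β * gen K c 1 with hwdef
    set s := (-β) • y 0 + α • y 1 with hsdef
    have hwC : α • y 0 + β • y 1 = C w := by
      rw [eq_C_of_natDegree_eq_zero hw, hCsmul, hCsmul, coeff_add, coeff_C_mul, coeff_C_mul, hy0, hy0]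
    have hw0 : w ≠ 0 := linear_form_gen_ne_zero hc hαβ
    let a := algebraMap K (PhamBrieskorn K ![2, 2, c]) (α ^ 2 + β ^ 2)
    have ha0 : a ≠ 0 := (map_ne_zero_iff _ (algebraMap K _).injective).2 hq
    have hs : s ^ 2 + C w ^ 2 + C a * y 2 ^ c = 0 := by
      rw [← hwC, hsdef]
      simp only [hCsmul, a, map_neg, map_add, map_pow]
      linear_combination (C (algebraMap K (PhamBrieskorn K ![2, 2, c]) α) ^ 2 +
        C (algebraMap K (PhamBrieskorn K ![2, 2, c]) β) ^ 2) * hyrel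
    have h2k : algebraMap k (PhamBrieskorn K ![2, 2, c]) 2 ≠ 0 :=
      (map_ne_zero_iff _ (algebraMap k _).injective).2 hk.two_ne_zero
    rw [map_ofNat] at h2k
    have hs0 : s.natDegree = 0 := by
      by_cases hcK : (c : PhamBrieskorn K ![2, 2, c]) = 0
      · obtain ⟨D, hD0, hD1⟩ := exists_rotation K c
        have hDw : D w ≠ 0 := by
          have : D w = algebraMap K _ β * gen K c 0 + algebraMap K _ (-α) * gen K c 1 := by
            rw [hwdef, D.map_add, D.leibniz, D.leibniz, D.map_algebraMap, D.map_algebraMap, hD0,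
              hD1, map_neg]
            simp only [smul_eq_mul]
            ring
          rw [this]
          refine linear_form_gen_ne_zero hc ?_
          rw [neg_ne_zero]
          exact hαβ.symm
        exact natDegree_eq_zero_of_derivation (D.restrictScalars ℤ) h2k hcK
          (D.map_algebraMap _) hw0 hDw hs
      · exact natDegree_eq_zero_of_catalan h2k (by obtain ⟨l, hl⟩ := hc; omega) hcK ha0 hw0 hs
    have hunit : ∀ p : (PhamBrieskorn K ![2, 2, c])[X],
        ((α ^ 2 + β ^ 2) • p).natDegree = 0 → p.natDegree = 0 := by
      intro p hp
      rwa [hCsmul, natDegree_C_mul ha0] at hp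
    have hlin : ∀ γ δ : K, (γ • C w + δ • s).natDegree = 0 := by
      intro γ δ
      rw [eq_C_of_natDegree_eq_zero hs0, smul_C, smul_C, ← C_add, natDegree_C]
    have e0 : (α ^ 2 + β ^ 2) • y 0 = α • C w + (-β) • s := by
      rw [← hwC, hsdef]; module
    have e1 : (α ^ 2 + β ^ 2) • y 1 = β • C w + α • s := by
      rw [← hwC, hsdef]; module
    rw [← hdeg, ← hdeg]
    exact ⟨hunit _ (e0 ▸ hlin _ _), hunit _ (e1 ▸ hlin _ _)⟩

/-- An exponential map is replaced by its homogenization, and one of its invariants by the top form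
of the latter, which is `Z ^ d` times a form in `X` and `Y`. If `d > 0` then `z` and hence
`x ^ 2 + y ^ 2` are constant, which leaves the case `d = 0` of a form in `X` and `Y`. -/
theorem isRigid (hc1 : 1 < c) (hc : Odd c) (hk : SumTwoSqAnisotropic k) :
    IsRigid k (PhamBrieskorn k ![2, 2, c]) := by
  rintro ⟨φ, hφ, hne⟩
  have := isDomain (k := k) hc
  have hB := sumTwoSqAnisotropic hc hk
  have hφ0 : ∀ i, (φ (gen k c i)).coeff 0 = gen k c i := fun i => by
    rw [coeff_zero_eq_eval_zero, hφ.eval_zero]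
  have hmoves : ∃ i, 0 < (φ (gen k c i)).natDegree := by
    by_contra! h
    refine hne (eq_top_iff.2 fun a _ => ?_)
    have : φ = CAlgHom := algHom_ext fun i => by
      rw [eq_C_of_natDegree_eq_zero (Nat.le_zero.1 (h i)), hφ0]; rfl
    exact DFunLike.congr_fun this a
  obtain ⟨x, hx0, ⟨i, hi⟩, hxrel, hxinv⟩ := exists_homogenization grading_gen grading_injective
    gen_ne_zero aeval_gen_surjective eval_one_grading hφ0 hmoves
  have hrel : x 0 ^ 2 + x 1 ^ 2 + x 2 ^ c = 0 := by
    have hX := MvPolynomial.isWeightedHomogeneous_X k (![c, c, 2] : Fin 3 → ℕ)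
    have hpow : MvPolynomial.IsWeightedHomogeneous (![c, c, 2] : Fin 3 → ℕ)
        (MvPolynomial.X 0 ^ 2 + MvPolynomial.X 1 ^ 2 + MvPolynomial.X 2 ^ c :
          MvPolynomial (Fin 3) k) (2 * c) := by
      refine (MvPolynomial.IsWeightedHomogeneous.add ?_ ?_).add ?_
      · simpa using (hX 0).pow 2
      · simpa using (hX 1).pow 2
      · simpa [mul_comm] using (hX 2).pow c
    simpa using hxrel _ _ hpow (by simpa using relation)
  -- If `x` and `y` are constant then so is `z`, and not all three of them are.
  have hxy : ¬ ((x 0).natDegree = 0 ∧ (x 1).natDegree = 0) := by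
    rintro ⟨h0, h1⟩
    have h2 : x 2 ^ c = C (-((x 0).coeff 0 ^ 2 + (x 1).coeff 0 ^ 2)) := by
      rw [C_neg, C_add, C_pow, C_pow, ← eq_C_of_natDegree_eq_zero h0,
        ← eq_C_of_natDegree_eq_zero h1]
      linear_combination hrel
    have h2 := congrArg natDegree h2
    rw [natDegree_pow, natDegree_C, mul_eq_zero] at h2
    have h2 := h2.resolve_left (by omega)
    fin_cases i <;> simp_all
  obtain ⟨f, hf, hfk⟩ := hφ.exists_invariant (linearIndependent_gen (k := k) (c := c))
  obtain ⟨F, hF, hFg, hFx⟩ := hxinv f hf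
  have hf0 : f ≠ 0 := by rintro rfl; exact hfk (zero_mem _)
  have hlc : (grading k c f).leadingCoeff ≠ 0 :=
    leadingCoeff_ne_zero.2 ((map_ne_zero_iff _ grading_injective).2 hf0)
  have hn : (grading k c f).natDegree ≠ 0 := by
    intro h0
    apply hfk
    have h1 := eval_one_grading f
    obtain ⟨G, hG⟩ := aeval_gen_surjective (k := k) f
    rw [eq_C_of_natDegree_eq_zero h0, eval_C, ← hG, coeff_grading_aeval grading_gen,
      MvPolynomial.weightedHomogeneousComponent_zero, MvPolynomial.algHom_C, hG] at h1
    · exact Submodule.mem_one.2 ⟨_, h1⟩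
    · have := hc.pos.ne'
      intro j; fin_cases j <;> simp [this]
  have hF0 : F ≠ 0 := by
    rintro rfl
    rw [map_zero] at hFg
    exact hlc hFg.symm
  obtain ⟨d, m, hdm, H, hH, hFH⟩ := exists_eq_pow_mul_form hc hF hF0
  have hxH : x 2 ^ d * MvPolynomial.aeval ![x 0, x 1] H = C (grading k c f).leadingCoeff := by
    let L := lift (k := k) x hrel
    have h1 := congrArg L hFH
    have h2 : ∀ j, L (gen k c j) = x j := lift_gen x hrel
    have h3 : (fun j => L (![gen k c 0, gen k c 1] j)) = ![x 0, x 1] := by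
      funext j; fin_cases j <;> simp [h2]
    rw [map_mul, map_pow, MvPolynomial.comp_aeval_apply, MvPolynomial.comp_aeval_apply, h3] at h1
    simp only [h2] at h1
    rw [← h1, hFx]
  rcases Nat.eq_zero_or_pos d with rfl | hd
  · rw [pow_zero, one_mul] at hxH
    refine hxy (natDegree_eq_zero_of_form (AlgebraicClosure k) hc1 hc hk hx0 hrel ?_ hH hlc hxH)
    rintro rfl
    omega
  · have h0 := hxH ▸ C_ne_zero.2 hlc
    have h1 := congrArg natDegree hxH
    rw [natDegree_mul (left_ne_zero_of_mul h0) (right_ne_zero_of_mul h0), natDegree_C,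
      natDegree_pow] at h1
    have h2 : (x 2).natDegree = 0 :=
      (mul_eq_zero.1 (Nat.eq_zero_of_add_eq_zero_right h1)).resolve_left hd.ne'
    apply hxy
    apply hB.natDegree_eq_zero
    have : x 0 ^ 2 + x 1 ^ 2 = C (-(x 2).coeff 0 ^ c) := by
      rw [C_neg, C_pow, ← eq_C_of_natDegree_eq_zero h2]
      linear_combination hrel
    rw [this, natDegree_C]

end PhamBrieskorn

/-! ### Exponential maps over algebraically closed fields -/

/-- To check that `φ` is an exponential map on an algebra generated by `g`, it suffices to look at
the generators. -/
lemma IsExponentialMap.of_generators {k A σ : Type*} [CommRing k] [CommRing A] [Algebra k A]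
    {g : σ → A} (hg : Function.Surjective (MvPolynomial.aeval g : MvPolynomial σ k → A))
    {φ : A →ₐ[k] A[X]} (h0 : ∀ i, (φ (g i)).eval 0 = g i)
    (h : ∀ i, (φ (g i)).map (φ : A →+* A[X]) =
      (φ (g i)).eval₂ ((C : A[X] →+* A[X][X]).comp (C : A →+* A[X])) (C X + X)) :
    IsExponentialMap φ := by
  constructor
  · intro a
    obtain ⟨F, rfl⟩ := hg a
    let f : A →ₐ[k] A := ((aeval (0 : A)).restrictScalars k).comp φ
    have hf : ∀ a, f a = (φ a).eval 0 := fun a => by simp [f]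
    rw [← hf, MvPolynomial.comp_aeval_apply]
    simp only [hf, h0]
  · intro a
    obtain ⟨F, rfl⟩ := hg a
    let f₁ : A →ₐ[k] A[X][X] := (mapAlgHom φ).comp φ
    let f₂ : A →ₐ[k] A[X][X] :=
      (eval₂AlgHom ((CAlgHom : A[X] →ₐ[k] A[X][X]).comp (CAlgHom : A →ₐ[k] A[X])) (C X + X)
        (fun _ => Commute.all _ _)).comp φ
    have h1 : ∀ a, f₁ a = (φ a).map (φ : A →+* A[X]) := fun a => rfl
    have h2 : ∀ a, f₂ a =
        (φ a).eval₂ ((C : A[X] →+* A[X][X]).comp (C : A →+* A[X])) (C X + X) := fun a => rfl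
    rw [← h1, ← h2, MvPolynomial.comp_aeval_apply, MvPolynomial.comp_aeval_apply]
    congr 2
    funext i
    rw [h1, h2, h]

/-- For a homomorphism fixing `u` and translating `z` by `u U`, the difference quotient
`q = ((z + u U) ^ n - z ^ n) / u` satisfies the cocycle identity `φ_V q = q (V + U) - q (V)`. -/
lemma map_eq_eval₂_sub_of_translation {A : Type*} [CommRing A] [IsDomain A] (φ : A →+* A[X])
    {u z : A} (hu : u ≠ 0) (hφu : φ u = C u) (hφz : φ z = C z + C u * X) {q : A[X]} {n : ℕ}
    (hq : C u * q = (C z + C u * X) ^ n - C z ^ n) :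
    q.map φ = q.eval₂ ((C : A[X] →+* A[X][X]).comp (C : A →+* A[X])) (C X + X) - C q := by
  have hu' : (C (C u) : A[X][X]) ≠ 0 := by simpa using hu
  apply mul_left_cancel₀ hu'
  have h1 := congrArg (map φ) hq
  have h2 := congrArg
    (eval₂ ((C : A[X] →+* A[X][X]).comp (C : A →+* A[X])) (C X + X)) hq
  have h3 := congrArg (C : A[X] →+* A[X][X]) hq
  simp only [Polynomial.map_mul, Polynomial.map_sub, Polynomial.map_add, Polynomial.map_pow, map_C,
    map_X, hφu, hφz] at h1
  simp only [eval₂_mul, eval₂_sub, eval₂_add, eval₂_pow, eval₂_C, eval₂_X, RingHom.comp_apply] at h2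
  simp only [map_mul, map_sub, map_add, map_pow] at h3
  rw [h1, mul_sub, h2, h3, map_add, map_mul]
  ring

lemma map_eq_eval₂_of_eq_sub_mul {A : Type*} [CommRing A] (φ : A →+* A[X]) {a t : A} {q : A[X]}
    (ht : φ t = C t)
    (hq : q.map φ = q.eval₂ ((C : A[X] →+* A[X][X]).comp (C : A →+* A[X])) (C X + X) - C q)
    (ha : φ a = C a - C t * q) :
    (φ a).map φ = (φ a).eval₂ ((C : A[X] →+* A[X][X]).comp (C : A →+* A[X])) (C X + X) := by
  rw [ha]
  simp only [Polynomial.map_mul, Polynomial.map_sub, map_C, eval₂_mul, eval₂_sub, eval₂_C,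
    RingHom.comp_apply, ha, ht, hq, map_sub, map_mul]
  ring

namespace PhamBrieskorn

variable {K : Type*} [Field K] {c : ℕ}

/-- An exponential map that moves a generator shows that the ring is not rigid. -/
lemma not_isRigid_of_moves {φ : PhamBrieskorn K ![2, 2, c] →ₐ[K] (PhamBrieskorn K ![2, 2, c])[X]}
    (hφ : IsExponentialMap φ) {i : Fin 3} (hi : φ (gen K c i) ≠ C (gen K c i)) :
    ¬ IsRigid K (PhamBrieskorn K ![2, 2, c]) := fun h =>
  h ⟨φ, hφ, fun htop => hi (by
    have : gen K c i ∈ expInvariants φ := htop ▸ Algebra.mem_top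
    exact this)⟩

/-- In characteristic `2` the equation is `(X + Y) ^ 2 + Z ^ c = 0`, and one can translate `X` and
`Y` by the same amount. -/
lemma not_isRigid_of_two_eq_zero (hc : Odd c) (h2 : (2 : K) = 0) :
    ¬ IsRigid K (PhamBrieskorn K ![2, 2, c]) := by
  have := isDomain (k := K) hc
  let B := PhamBrieskorn K ![2, 2, c]
  have h2B : (2 : B[X]) = 0 := by
    have := congrArg (algebraMap K B[X]) h2
    rwa [map_ofNat, map_zero] at this
  let φ : B →ₐ[K] B[X] := lift ![C (gen K c 0) + X, C (gen K c 1) + X, C (gen K c 2)] (by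
    simp only [Matrix.cons_val]
    have hr : C (gen K c 0) ^ 2 + C (gen K c 1) ^ 2 + C (gen K c 2) ^ c = (0 : B[X]) := by
      rw [← C_pow, ← C_pow, ← C_pow, ← C_add, ← C_add, relation, C_0]
    linear_combination hr + (C (gen K c 0) * X + C (gen K c 1) * X + X ^ 2) * h2B)
  have hφ0 : φ (gen K c 0) = C (gen K c 0) + X := lift_gen _ _ _
  have hφ1 : φ (gen K c 1) = C (gen K c 1) + X := lift_gen _ _ _
  have hφ2 : φ (gen K c 2) = C (gen K c 2) := lift_gen _ _ _
  refine not_isRigid_of_moves (φ := φ) (i := 0)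
    (IsExponentialMap.of_generators aeval_gen_surjective ?_ ?_) ?_
  · rw [Fin.forall_fin_succ, Fin.forall_fin_two]
    simp [hφ0, hφ1, hφ2]
  · rw [Fin.forall_fin_succ, Fin.forall_fin_two]
    simp [hφ0, hφ1, hφ2, add_assoc]
  · rw [hφ0]
    intro h
    exact X_ne_zero (add_eq_left.1 h)

/-- If `ι ^ 2 = -1` then with `u = X + ι Y` and `v = X - ι Y` the equation is `u v = -Z ^ c`, and the
map that fixes `u` and sends `Z` to `Z + u U` extends to `v`. -/
lemma not_isRigid_of_sq_eq_neg_one (hc : Odd c) (h2 : (2 : K) ≠ 0) {ι : K} (hι : ι ^ 2 = -1) :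
    ¬ IsRigid K (PhamBrieskorn K ![2, 2, c]) := by
  have := isDomain (k := K) hc
  let B := PhamBrieskorn K ![2, 2, c]
  let i : B := algebraMap K B ι
  let t : B := algebraMap K B 2⁻¹
  have hi : i ^ 2 = -1 := by rw [← map_pow, hι, map_neg, map_one]
  have ht : 2 * t = 1 := by
    rw [← map_ofNat (algebraMap K B) 2, ← map_mul, mul_inv_cancel₀ h2, map_one]
  let u : B := gen K c 0 + i * gen K c 1
  have hu : u ≠ 0 := by
    have := linear_form_gen_ne_zero (k := K) (c := c) hc (α := 1) (β := ι) (Or.inl one_ne_zero)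
    rwa [map_one, one_mul] at this
  -- `v` is sent to `v - q`, where `u q = (Z + u U) ^ c - Z ^ c`
  let q : B[X] := X * ∑ j ∈ Finset.range c,
    (C (gen K c 2) + C u * X) ^ j * C (gen K c 2) ^ (c - 1 - j)
  have hq : C u * q = (C (gen K c 2) + C u * X) ^ c - C (gen K c 2) ^ c := by
    rw [← (Commute.all (C (gen K c 2) + C u * X : B[X]) (C (gen K c 2))).mul_geom_sum₂]
    simp only [q]
    ring
  let φ : B →ₐ[K] B[X] := lift ![C (gen K c 0) - C t * q, C (gen K c 1) - C (t * i) * q,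
      C (gen K c 2) + C u * X] (by
    simp only [Matrix.cons_val]
    have hr : C (gen K c 0) ^ 2 + C (gen K c 1) ^ 2 + C (gen K c 2) ^ c = (0 : B[X]) := by
      rw [← C_pow, ← C_pow, ← C_pow, ← C_add, ← C_add, relation, C_0]
    have hiC : C i ^ 2 = (-1 : B[X]) := by rw [← C_pow, hi, C_neg, C_1]
    have htC : 2 * C t = (1 : B[X]) := by
      rw [← C_1, ← ht, C_mul, C_ofNat]
    have huC : C u = C (gen K c 0) + C i * C (gen K c 1) := by rw [← C_mul, ← C_add]
    rw [C_mul]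
    linear_combination hr - hq + q * huC -
      q * (C (gen K c 0) + C i * C (gen K c 1)) * htC + C t ^ 2 * q ^ 2 * hiC)
  have hφ0 : φ (gen K c 0) = C (gen K c 0) - C t * q := lift_gen _ _ _
  have hφ1 : φ (gen K c 1) = C (gen K c 1) - C (t * i) * q := lift_gen _ _ _
  have hφ2 : φ (gen K c 2) = C (gen K c 2) + C u * X := lift_gen _ _ _
  have hφC : ∀ r : K, φ (algebraMap K B r) = C (algebraMap K B r) := fun r => φ.commutes r
  have hφu : φ u = C u := by
    simp only [u, map_add, map_mul, hφ0, hφ1, i, t, hφC]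
    have hiC : C i ^ 2 = (-1 : B[X]) := by rw [← C_pow, hi, C_neg, C_1]
    linear_combination (-C t * q) * hiC
  refine not_isRigid_of_moves (φ := φ) (i := 2)
    (IsExponentialMap.of_generators aeval_gen_surjective ?_ ?_) ?_
  · rw [Fin.forall_fin_succ, Fin.forall_fin_two]
    simp [hφ0, hφ1, hφ2, q]
  · have hq' := map_eq_eval₂_sub_of_translation (φ : B →+* B[X]) hu hφu hφ2 hq
    rw [Fin.forall_fin_succ, Fin.forall_fin_two]
    refine ⟨map_eq_eval₂_of_eq_sub_mul _ (hφC _) hq' hφ0,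
      map_eq_eval₂_of_eq_sub_mul _ ?_ hq' hφ1, ?_⟩
    · change φ (t * i) = C (t * i)
      rw [map_mul, C_mul]
      exact congrArg₂ _ (hφC _) (hφC _)
    · change (φ (gen K c 2)).map (φ : B →+* B[X]) = (φ (gen K c 2)).eval₂ _ _
      rw [hφ2]
      simp [hφ2, hφu, mul_add, add_assoc]
  · rw [hφ2]
    intro h
    have := (mul_eq_zero.1 (add_eq_left.1 h)).resolve_right X_ne_zero
    exact hu (C_eq_zero.1 this)

end PhamBrieskorn

theorem mainTheorem11 (c : ℕ) (hc : 1 < c) (hodd : Odd c) :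
    (∀ (k : Type*) [Field k], ringChar k ≠ 2 → (¬ ∃ i : k, i ^ 2 = -1) →
      IsRigid k (PhamBrieskorn k ![2, 2, c])) ∧
    (∀ (K : Type*) [Field K] [IsAlgClosed K],
      ¬ IsRigid K (PhamBrieskorn K ![2, 2, c])) := by
  refine ⟨fun k _ _ hk => PhamBrieskorn.isRigid hc hodd (.of_field hk), fun K _ _ => ?_⟩
  by_cases h2 : (2 : K) = 0
  · exact PhamBrieskorn.not_isRigid_of_two_eq_zero hodd h2
  · obtain ⟨ι, hι⟩ := IsAlgClosed.exists_pow_nat_eq (-1 : K) two_pos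
    exact PhamBrieskorn.not_isRigid_of_sq_eq_neg_one hodd h2 hι
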